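/- Let $G$ be a totally ordered abelian group which is divisible, and fix an embedding $\mathbb{Z} \hookrightarrow G$ of ordered groups, through which integers are regarded as elements of $G$. Let $p$ be a prime, let $R$ be an algebraically closed field of characteristic $p$, and let $W(R)$ be its ring of ($p$-typical) Witt vectors. Let $W(R)((t^G))$ be the ring of formal series $x = \sum_{i \in G} x_i t^i$ with $x_i \in W(R)$ and well-ordered support $\{i \in G : x_i \neq 0\}$, with the usual addition and multiplication of series. Call such an $x$ null if $$\sum_{n \in \mathbb{Z}} x_{i+n}\, p^n = 0 \qquad \text{for every } i \in G,$$ where the sum, which has only finitely many nonzero terms with $n < 0$, is a $p$-adically convergent sum in $W(R)[1/p]$. The null series form an ideal of $W(R)((t^G))$. Let $W(R)((p^G))$, Poonen's ring of $p$-adic series over $W(R)$ with value group $G$, be the quotient of $W(R)((t^G))$ by this ideal. Then $W(R)((p^G))$ is a field, and it is algebraically closed. -/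

import Mathlib

set_option linter.unusedSectionVars false

namespace GenPadic

section

variable {G : Type*} [AddCommGroup G] [LinearOrder G] [IsOrderedAddMonoid G]
variable {p : ℕ} [Fact p.Prime] {k : Type*} [Field k] [CharP k p]

/-- `∑_{n ≥ 0} a n = s` in the `p`-adic topology of `W(k)`: for every `e`, the partial sums are
eventually congruent to `s` modulo `p ^ e`. -/
def HasPadicSum (a : ℕ → WittVector p k) (s : WittVector p k) : Prop :=
  ∀ e : ℕ, ∀ᶠ N in Filter.atTop,
    (∑ n ∈ Finset.range N, a n) - s ∈ Ideal.span {(p : WittVector p k) ^ e}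

/-- A generalized power series `x = ∑ x_i t^i` in `W(k)((t^G))` is null if it becomes zero on
setting `t = p`, i.e. if `∑_{n ∈ ℤ} x_{i+n} p^n = 0` for every `i ∈ G`, where `ℤ` is regarded
as a subgroup of `G` through `ι`. As the support of `x` is well-ordered, there is `m` such that
`x_{i+n} = 0` for all `n < -m`; the condition is written after multiplication by `p ^ m`,
as the equation `∑_{n ≥ 0} x_{i-m+n} p^n = 0` in `W(k)`, in which `p` is a nonzerodivisor. -/
def IsNull (ι : ℤ →+o G) (x : HahnSeries G (WittVector p k)) : Prop :=
  ∀ i : G, ∃ m : ℕ, (∀ n : ℕ, m < n → x.coeff (i - ι (n : ℤ)) = 0) ∧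
    HasPadicSum (fun n : ℕ => x.coeff (i - ι (m : ℤ) + ι (n : ℤ)) * (p : WittVector p k) ^ n) 0

theorem hasPadicSum_zero_iff (c : ℕ → WittVector p k) :
    HasPadicSum (fun n : ℕ => c n * (p : WittVector p k) ^ n) 0 ↔
      ∀ N : ℕ, (p : WittVector p k) ^ N ∣
        ∑ n ∈ Finset.range N, c n * (p : WittVector p k) ^ n := by
  have key : ∀ N r : ℕ, (p : WittVector p k) ^ N ∣
      ∑ n ∈ Finset.range r, c (N + n) * (p : WittVector p k) ^ (N + n) := fun N r =>
    Finset.dvd_sum fun n _ => Dvd.dvd.mul_left (pow_dvd_pow _ (Nat.le_add_right N n)) _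
  constructor
  · intro h N
    obtain ⟨M, hM, hNM⟩ := ((h N).and (Filter.eventually_ge_atTop N)).exists
    obtain ⟨r, rfl⟩ := Nat.exists_eq_add_of_le hNM
    rw [sub_zero, Ideal.mem_span_singleton, Finset.sum_range_add] at hM
    exact (dvd_add_left (key N r)).1 hM
  · intro h e
    filter_upwards [Filter.eventually_ge_atTop e] with M hM
    rw [sub_zero, Ideal.mem_span_singleton]
    exact (pow_dvd_pow _ hM).trans (h M)

theorem strictMono_of_injective (ι : ℤ →+o G) (hι : Function.Injective ι) : StrictMono ι :=
  ι.monotone'.strictMono_of_injective hι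

theorem exists_forall_notMem (ι : ℤ →+o G) (hι : Function.Injective ι) {S : Set G}
    (hS : S.IsPWO) (i : G) : ∃ m : ℕ, ∀ n : ℕ, m < n → i - ι (n : ℤ) ∉ S := by
  by_cases hne : (S ∩ Set.range fun n : ℕ => i - ι (n : ℤ)).Nonempty
  · have hwf : (S ∩ Set.range fun n : ℕ => i - ι (n : ℤ)).IsWF :=
      hS.isWF.mono Set.inter_subset_left
    obtain ⟨_, m, hm⟩ := hwf.min_mem hne
    refine ⟨m, fun n hn hmem => hwf.not_lt_min hne ⟨hmem, n, rfl⟩ ?_⟩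
    rw [← hm]
    have : ι (m : ℤ) < ι (n : ℤ) := strictMono_of_injective ι hι (by exact_mod_cast hn)
    exact sub_lt_sub_left this i
  · exact ⟨0, fun n _ hmem => hne ⟨_, hmem, n, rfl⟩⟩

theorem IsNull.dvd {ι : ℤ →+o G} {x : HahnSeries G (WittVector p k)} (hx : IsNull ι x) {i : G}
    (hi : ∀ n : ℕ, 0 < n → x.coeff (i - ι (n : ℤ)) = 0) (N : ℕ) :
    (p : WittVector p k) ^ N ∣
      ∑ n ∈ Finset.range N, x.coeff (i + ι (n : ℤ)) * (p : WittVector p k) ^ n := by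
  obtain ⟨m, -, hm⟩ := hx i
  have h := (hasPadicSum_zero_iff (fun n : ℕ => x.coeff (i - ι (m : ℤ) + ι (n : ℤ)))).1 hm (m + N)
  rw [Finset.sum_range_add, Finset.sum_eq_zero, zero_add] at h
  · have h2 : ∑ n ∈ Finset.range N, x.coeff (i - ι (m : ℤ) + ι ((m + n : ℕ) : ℤ)) *
        (p : WittVector p k) ^ (m + n) = (p : WittVector p k) ^ m *
        ∑ n ∈ Finset.range N, x.coeff (i + ι (n : ℤ)) * (p : WittVector p k) ^ n := by
      rw [Finset.mul_sum]
      refine Finset.sum_congr rfl fun n _ => ?_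
      rw [Nat.cast_add, map_add, ← add_assoc, sub_add_cancel]
      ring
    rw [h2, pow_add] at h
    exact (mul_dvd_mul_iff_left (pow_ne_zero m (WittVector.p_nonzero p k))).1 h
  · intro n hn
    have hn' := Finset.mem_range.1 hn
    have h3 : i - ι (m : ℤ) + ι (n : ℤ) = i - ι ((m - n : ℕ) : ℤ) := by
      rw [Nat.cast_sub hn'.le, map_sub]
      abel
    rw [h3, hi _ (Nat.sub_pos_of_lt hn'), zero_mul]

theorem isNull_of_dvd {ι : ℤ →+o G} {x : HahnSeries G (WittVector p k)}
    (h : ∀ i : G, ∃ m : ℕ, (∀ n : ℕ, m < n → x.coeff (i - ι (n : ℤ)) = 0) ∧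
      ∀ N : ℕ, (p : WittVector p k) ^ N ∣ ∑ n ∈ Finset.range N,
        x.coeff (i - ι (m : ℤ) + ι (n : ℤ)) * (p : WittVector p k) ^ n) : IsNull ι x := by
  intro i
  obtain ⟨m, hm, hd⟩ := h i
  exact ⟨m, hm, (hasPadicSum_zero_iff (fun n : ℕ => x.coeff (i - ι (m : ℤ) + ι (n : ℤ)))).2 hd⟩

theorem coeff_shift_eq_zero {ι : ℤ →+o G} {S : Set G} {i : G} {m : ℕ}
    (hm : ∀ n : ℕ, m < n → i - ι (n : ℤ) ∉ S) {n : ℕ} (hn : 0 < n) :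
    i - ι (m : ℤ) - ι (n : ℤ) ∉ S := by
  have := hm (m + n) (by omega)
  rwa [Nat.cast_add, map_add, ← sub_sub] at this

theorem isNull_zero (ι : ℤ →+o G) : IsNull ι (0 : HahnSeries G (WittVector p k)) :=
  isNull_of_dvd fun _ => ⟨0, by simp, by simp⟩

theorem IsNull.add {ι : ℤ →+o G} (hι : Function.Injective ι)
    {x y : HahnSeries G (WittVector p k)} (hx : IsNull ι x) (hy : IsNull ι y) :
    IsNull ι (x + y) := by
  refine isNull_of_dvd fun i => ?_
  obtain ⟨m, hm⟩ := exists_forall_notMem ι hι (x.isPWO_support.union y.isPWO_support) i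
  have hx0 : ∀ g, g ∉ x.support ∪ y.support → x.coeff g = 0 := fun g hg => by
    by_contra h
    exact hg (Or.inl h)
  have hy0 : ∀ g, g ∉ x.support ∪ y.support → y.coeff g = 0 := fun g hg => by
    by_contra h
    exact hg (Or.inr h)
  refine ⟨m, fun n hn => ?_, fun N => ?_⟩
  · rw [HahnSeries.coeff_add, hx0 _ (hm n hn), hy0 _ (hm n hn), add_zero]
  · simp only [HahnSeries.coeff_add, add_mul, Finset.sum_add_distrib]
    exact dvd_add
      (hx.dvd (fun n hn => hx0 _ (coeff_shift_eq_zero hm hn)) N)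
      (hy.dvd (fun n hn => hy0 _ (coeff_shift_eq_zero hm hn)) N)

open scoped Classical in
theorem coeff_mul_eq_sum (y x : HahnSeries G (WittVector p k)) (g : G) {B : Finset G}
    (hB : (Finset.antidiagonal y.isPWO_support x.isPWO_support g).image Prod.fst ⊆ B) :
    (y * x).coeff g = ∑ a ∈ B, y.coeff a * x.coeff (g - a) := by
  rw [HahnSeries.coeff_mul, ← Finset.sum_subset hB, Finset.sum_image]
  · refine Finset.sum_congr rfl fun ab hab => ?_
    rw [← (Finset.mem_antidiagonal.1 hab).2.2, add_sub_cancel_left]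
  · intro u hu v hv huv
    have h1 := (Finset.mem_antidiagonal.1 hu).2.2
    have h2 := (Finset.mem_antidiagonal.1 hv).2.2
    refine Prod.ext huv ?_
    have huv' : u.1 = v.1 := huv
    rw [← h2, huv'] at h1
    exact add_left_cancel h1
  · intro a _ ha
    by_contra hne
    refine ha (Finset.mem_image.2 ⟨(a, g - a), Finset.mem_antidiagonal.2 ⟨?_, ?_, ?_⟩, rfl⟩)
    · exact left_ne_zero_of_mul hne
    · exact right_ne_zero_of_mul hne
    · exact add_sub_cancel a g

open scoped Classical Pointwise in
theorem IsNull.mul_left {ι : ℤ →+o G} (hι : Function.Injective ι)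
    (y : HahnSeries G (WittVector p k)) {x : HahnSeries G (WittVector p k)} (hx : IsNull ι x) :
    IsNull ι (y * x) := by
  refine isNull_of_dvd fun i => ?_
  obtain ⟨m, hm⟩ := exists_forall_notMem ι hι (y.isPWO_support.add x.isPWO_support) i
  refine ⟨m, fun n hn => ?_, fun N => ?_⟩
  · by_contra hne
    exact hm n hn (HahnSeries.support_mul_subset hne)
  · set j := i - ι (m : ℤ) with hj
    set B : Finset G := (Finset.range N).biUnion fun n =>
      (Finset.antidiagonal y.isPWO_support x.isPWO_support (j + ι (n : ℤ))).image Prod.fst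
      with hB
    have h1 : ∑ n ∈ Finset.range N, (y * x).coeff (j + ι (n : ℤ)) * (p : WittVector p k) ^ n =
        ∑ a ∈ B, y.coeff a *
          ∑ n ∈ Finset.range N, x.coeff (j - a + ι (n : ℤ)) * (p : WittVector p k) ^ n := by
      simp only [Finset.mul_sum]
      rw [Finset.sum_comm]
      refine Finset.sum_congr rfl fun n hn => ?_
      rw [coeff_mul_eq_sum y x _ (Finset.subset_biUnion_of_mem (fun n : ℕ =>
        (Finset.antidiagonal y.isPWO_support x.isPWO_support (j + ι (n : ℤ))).image Prod.fst)
        hn), Finset.sum_mul]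
      refine Finset.sum_congr rfl fun a _ => ?_
      rw [mul_assoc, add_sub_right_comm]
    rw [h1]
    refine Finset.dvd_sum fun a _ => ?_
    by_cases ha : y.coeff a = 0
    · rw [ha, zero_mul]
      exact dvd_zero _
    · refine Dvd.dvd.mul_left (hx.dvd (fun n hn => ?_) N) _
      by_contra hne
      refine coeff_shift_eq_zero hm hn (Set.mem_add.2 ⟨a, ha, j - a - ι (n : ℤ), hne, ?_⟩)
      rw [hj]
      abel

/-- The ideal of null series in `W(k)((t^G))`. -/
def nullIdeal (p : ℕ) [Fact p.Prime] (k : Type*) [Field k] [CharP k p]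
    (ι : ℤ →+o G) (hι : Function.Injective ι) : Ideal (HahnSeries G (WittVector p k)) where
  carrier := {x | IsNull ι x}
  zero_mem' := isNull_zero ι
  add_mem' := fun hx hy => IsNull.add hι hx hy
  smul_mem' := fun y _ hx => IsNull.mul_left hι y hx

/-- Poonen's ring `W(k)((p^G))` of `p`-adic series over `W(k)` with value group `G`, for an
ordered abelian group `G` with a fixed embedding `ι : ℤ → G` of ordered groups: the quotient of
`W(k)((t^G))` by the ideal of null series. -/
abbrev PadicSeries (p : ℕ) [Fact p.Prime] (k : Type*) [Field k] [CharP k p]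
    (ι : ℤ →+o G) (hι : Function.Injective ι) : Type _ :=
  HahnSeries G (WittVector p k) ⧸ nullIdeal p k ι hι

end

end GenPadic

/-! Along a coset of `ℤ`, a series sums at `t = p` to an element of `W(k)[1/p]`. Expanding it in
Teichmüller digits shows that every class contains a series `∑ [r_g] t^g` with `r` in `k((t^G))`
(`exists_isNull_sub_teichmullerSeries`). Factoring out the leading power of `t` writes a nonzero
class as `t^g` times a series with support in `[0, ∞)` and nonzero residue, which is a unit. Hence
the quotient is a field, valued by `G`, with residue field `k`.

Two classes are within `v(t^g)` of each other exactly when their digits agree below `g`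
(`valuation_sub_teichmullerSeries_le_iff`), so pairwise meeting balls have a common point, found by
gluing digits: the field is spherically complete.

With a divisible value group and algebraically closed residue field, this forces algebraic
closedness (`isAlgClosed_of_sphericallyComplete`). If `f` has no root, attach to each `a` the ball
reaching its nearest root. Zorn gives a minimal such ball, yet a root over the residue field always
yields a point of the ball where `f` is strictly smaller. -/

namespace GenPadic

open Polynomial

/-! ### Spherically complete valued fields and root radii -/

section SphericallyComplete

variable {K Γ₀ : Type*} [Field K] [LinearOrderedCommGroupWithZero Γ₀]

theorem valuation_natCast_le_one (v : Valuation K Γ₀) (n : ℕ) : v (n : K) ≤ 1 := by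
  induction n with
  | zero => simp
  | succ n ih =>
    rw [Nat.cast_succ]
    exact (v.map_add _ _).trans (max_le ih (by simp))

theorem taylor_coeff_mul_pow_eq_sum (f : K[X]) (d y : K) (n : ℕ) :
    (taylor d f).coeff n * y ^ n = ∑ k ∈ Finset.range ((hasseDeriv n f).natDegree + 1),
      ((k + n).choose n : K) * f.coeff (k + n) * d ^ k * y ^ n := by
  rw [taylor_coeff, eval_eq_sum_range, Finset.sum_mul]
  simp_rw [hasseDeriv_coeff]

theorem valuation_taylor_term_le (v : Valuation K Γ₀) (f : K[X]) {d y : K} (hd : v d ≤ v y)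
    (n k : ℕ) : v (((k + n).choose n : K) * f.coeff (k + n) * d ^ k * y ^ n) ≤
      v (f.coeff (k + n) * y ^ (k + n)) := by
  simp only [map_mul, map_pow, pow_add]
  calc _ ≤ 1 * v (f.coeff (k + n)) * v y ^ k * v y ^ n := by
        gcongr
        exact valuation_natCast_le_one v _
    _ = _ := by rw [one_mul, mul_assoc]

/-- Binomial coefficients have valuation at most 1, and only terms of index at least `n` feed the
new `n`-th coefficient, so recentring within the ball of radius `v y` cannot enlarge a tail bound.
-/
theorem valuation_taylor_coeff_le (v : Valuation K Γ₀) (f : K[X]) {d y : K} (hd : v d ≤ v y)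
    {n : ℕ} {B : Γ₀} (h : ∀ k, n ≤ k → v (f.coeff k * y ^ k) ≤ B) :
    v ((taylor d f).coeff n * y ^ n) ≤ B := by
  rw [taylor_coeff_mul_pow_eq_sum]
  exact v.map_sum_le fun k _ =>
    (valuation_taylor_term_le v f hd n k).trans (h _ (Nat.le_add_left n k))

theorem valuation_taylor_coeff_lt (v : Valuation K Γ₀) (f : K[X]) {d y : K} (hd : v d ≤ v y)
    {n : ℕ} {B : Γ₀} (hB : B ≠ 0) (h : ∀ k, n ≤ k → v (f.coeff k * y ^ k) < B) :
    v ((taylor d f).coeff n * y ^ n) < B := by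
  rw [taylor_coeff_mul_pow_eq_sum]
  exact v.map_sum_lt hB fun k _ =>
    (valuation_taylor_term_le v f hd n k).trans_lt (h _ (Nat.le_add_left n k))

/-- `v y` is the distance from `a` to a nearest root of `f`, read off the Newton polygon of
`f (a + X)`. -/
structure IsRootRadius (v : Valuation K Γ₀) (f : K[X]) (a y : K) : Prop where
  le : ∀ i, v ((taylor a f).coeff i * y ^ i) ≤ v (f.eval a)
  eq : ∃ i, i ≠ 0 ∧ v ((taylor a f).coeff i * y ^ i) = v (f.eval a)

open scoped Classical in
-- Each nonzero coefficient of index `i ≠ 0` has a radius at which its term ties with the constant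
-- term; the smallest of these radii works.
theorem exists_isRootRadius (v : Valuation K Γ₀)
    (hdiv : ∀ n : ℕ, n ≠ 0 → ∀ c : K, ∃ y, v y ^ n = v c) {f : K[X]} (hf : f.natDegree ≠ 0)
    {a : K} : ∃ y, IsRootRadius v f a y := by
  have h1 : ∀ i : ℕ, ∃ y, i ≠ 0 → (taylor a f).coeff i ≠ 0 →
      v ((taylor a f).coeff i * y ^ i) = v (f.eval a) := by
    intro i
    by_cases hi : i = 0
    · exact ⟨0, fun h => absurd hi h⟩
    obtain ⟨y, hy⟩ := hdiv i hi (f.eval a / (taylor a f).coeff i)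
    refine ⟨y, fun _ hc => ?_⟩
    rw [map_mul, map_pow, hy, ← map_mul, mul_div_cancel₀ _ hc]
  choose y hy using h1
  set S := (Finset.range (f.natDegree + 1)).filter
    fun i => i ≠ 0 ∧ (taylor a f).coeff i ≠ 0 with hS
  have hlead : (taylor a f).coeff f.natDegree ≠ 0 := by
    rw [← natDegree_taylor f a, coeff_natDegree, Ne, leadingCoeff_eq_zero]
    intro h
    rw [← natDegree_taylor f a, h] at hf
    exact hf natDegree_zero
  have hne : S.Nonempty := ⟨f.natDegree, Finset.mem_filter.2 ⟨Finset.self_mem_range_succ _, hf, hlead⟩⟩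
  obtain ⟨i, hiS, hi⟩ := S.exists_min_image (fun i => v (y i)) hne
  simp only [hS, Finset.mem_filter] at hiS
  refine ⟨y i, fun j => ?_, i, hiS.2.1, hy i hiS.2.1 hiS.2.2⟩
  rcases eq_or_ne j 0 with rfl | hj
  · simp [taylor_coeff_zero]
  rcases eq_or_ne ((taylor a f).coeff j) 0 with hc | hc
  · simp [hc]
  have hjS : j ∈ S := by
    simp only [hS, Finset.mem_filter, Finset.mem_range]
    refine ⟨?_, hj, hc⟩
    rw [Nat.lt_succ_iff, ← natDegree_taylor f a]
    exact le_natDegree_of_ne_zero hc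
  rw [← hy j hj hc, map_mul, map_mul, map_pow, map_pow]
  gcongr
  exact hi j hjS

theorem taylor_eq_taylor_sub (f : K[X]) (a b : K) :
    taylor b f = taylor (b - a) (taylor a f) := by
  rw [taylor_taylor]
  congr 2
  ring

theorem IsRootRadius.valuation_eval_le {v : Valuation K Γ₀} {f : K[X]} {a y b : K}
    (h : IsRootRadius v f a y) (hb : v (b - a) ≤ v y) : v (f.eval b) ≤ v (f.eval a) := by
  have := valuation_taylor_coeff_le v (taylor a f) hb (n := 0) fun k _ => h.le k
  rwa [← taylor_eq_taylor_sub, taylor_coeff_zero, pow_zero, mul_one] at this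

/-- Let `i` be the tying index at `a`. If at `b` all terms of index at least `i` were smaller than
`f(a)` on radius `y`, recentring back to `a` would contradict the tie. So some term of index `k ≥ i`
is at least `f(a)`, hence at least `f(b)`, which bounds the same term on radius `z`. -/
theorem IsRootRadius.radius_le {v : Valuation K Γ₀} {f : K[X]} {a y b z : K}
    (h : IsRootRadius v f a y) (hb : v (b - a) ≤ v y) (ha : f.eval a ≠ 0)
    (h' : IsRootRadius v f b z) : v z ≤ v y := by
  obtain ⟨i, hi, hie⟩ := h.eq
  have ha' : v (f.eval a) ≠ 0 := (v.ne_zero_iff).2 ha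
  obtain ⟨k, hk, hlt⟩ : ∃ k, i ≤ k ∧
      v (f.eval a) ≤ v ((taylor b f).coeff k * y ^ k) := by
    by_contra! hcon
    have h2 := valuation_taylor_coeff_lt v (taylor b f) (d := a - b)
      (by rwa [v.map_sub_swap]) ha' hcon
    rw [← taylor_eq_taylor_sub, hie] at h2
    exact lt_irrefl _ h2
  have h3 : v ((taylor b f).coeff k * z ^ k) ≤ v ((taylor b f).coeff k * y ^ k) :=
    (h'.le k).trans ((h.valuation_eval_le hb).trans hlt)
  have h4 : v ((taylor b f).coeff k) ≠ 0 := fun h0 => by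
    rw [map_mul, h0, zero_mul] at hlt
    exact ha' (le_zero_iff.1 hlt)
  rw [map_mul, map_mul, map_pow, map_pow] at h3
  have h5 := le_of_mul_le_mul_left h3 (zero_lt_iff.2 h4)
  exact le_of_pow_le_pow_left₀ (by omega) zero_le h5

theorem IsRootRadius.ne_zero {v : Valuation K Γ₀} {f : K[X]} {a y : K}
    (h : IsRootRadius v f a y) (ha : f.eval a ≠ 0) : y ≠ 0 := by
  rintro rfl
  obtain ⟨i, hi, hie⟩ := h.eq
  rw [zero_pow hi, mul_zero, map_zero] at hie
  exact ha ((v.zero_iff).1 hie.symm)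

/-- The polynomial `f(a + yX) / f(a)` is integral with nonconstant reduction; a lift of a root of
the reduction gives the step from `a` to `b`. -/
theorem IsRootRadius.exists_valuation_eval_lt {v : Valuation K Γ₀}
    (hres : ∀ q : K[X], (∀ i, v (q.coeff i) ≤ 1) → (∃ i, i ≠ 0 ∧ v (q.coeff i) = 1) →
      ∃ u, v u ≤ 1 ∧ v (q.eval u) < 1)
    {f : K[X]} {a y : K} (h : IsRootRadius v f a y) (ha : f.eval a ≠ 0) :
    ∃ b, v (b - a) ≤ v y ∧ v (f.eval b) < v (f.eval a) := by
  have ha' : v (f.eval a) ≠ 0 := (v.ne_zero_iff).2 ha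
  set q : K[X] := C (f.eval a)⁻¹ * ((taylor a f).comp (C y * X)) with hq
  have hqc : ∀ i, v (q.coeff i) = (v (f.eval a))⁻¹ * v ((taylor a f).coeff i * y ^ i) := by
    intro i
    rw [hq, coeff_C_mul, comp_C_mul_X_coeff, map_mul, map_inv₀]
  obtain ⟨u, hu, hqu⟩ := hres q
    (fun i => by
      rw [hqc, inv_mul_le_iff₀ (zero_lt_iff.2 ha'), mul_one]
      exact h.le i)
    (by
      obtain ⟨i, hi, hie⟩ := h.eq
      exact ⟨i, hi, by rw [hqc, hie, inv_mul_cancel₀ ha']⟩)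
  refine ⟨a + y * u, ?_, ?_⟩
  · rw [add_sub_cancel_left, map_mul]
    exact mul_le_of_le_one_right' hu
  · have : q.eval u = (f.eval a)⁻¹ * f.eval (a + y * u) := by
      rw [hq, eval_mul, eval_C, eval_comp, taylor_eval]
      simp [add_comm]
    rw [this, map_mul, map_inv₀, inv_mul_lt_iff₀ (zero_lt_iff.2 ha'), mul_one] at hqu
    exact hqu

/-- A spherically complete valued field with divisible value group and algebraically closed
residue field is algebraically closed. -/
theorem isAlgClosed_of_sphericallyComplete (v : Valuation K Γ₀)
    (hdiv : ∀ n : ℕ, n ≠ 0 → ∀ c : K, ∃ y, v y ^ n = v c)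
    (hres : ∀ q : K[X], (∀ i, v (q.coeff i) ≤ 1) → (∃ i, i ≠ 0 ∧ v (q.coeff i) = 1) →
      ∃ u, v u ≤ 1 ∧ v (q.eval u) < 1)
    (hsph : ∀ C : Set (K × K), (∀ x ∈ C, x.2 ≠ 0) →
      (∀ x ∈ C, ∀ y ∈ C, v (x.1 - y.1) ≤ max (v x.2) (v y.2)) →
      ∃ c, ∀ x ∈ C, v (c - x.1) ≤ v x.2) : IsAlgClosed K := by
  refine IsAlgClosed.of_exists_root K fun f _ hirr => ?_
  by_contra! hroot
  have hf : f.natDegree ≠ 0 := hirr.natDegree_pos.ne'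
  -- The first two conditions make balls shrink; the third lets a strict decrease of `f` contradict
  -- maximality.
  let r : {x : K × K // IsRootRadius v f x.1 x.2} →
      {x : K × K // IsRootRadius v f x.1 x.2} → Prop := fun x y =>
    v (y.1.1 - x.1.1) ≤ v x.1.2 ∧ v y.1.2 ≤ v x.1.2 ∧ v (f.eval y.1.1) ≤ v (f.eval x.1.1)
  obtain ⟨m, hm⟩ := exists_maximal_of_chains_bounded (r := r) (fun C hC => by
      obtain ⟨c, hc⟩ := hsph (Subtype.val '' C)
        (by
          rintro _ ⟨x, -, rfl⟩
          exact x.2.ne_zero (hroot _))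
        (by
          rintro _ ⟨x, hx, rfl⟩ _ ⟨y, hy, rfl⟩
          rcases eq_or_ne x y with rfl | hxy
          · simp
          rcases hC hx hy hxy with h | h
          · rw [v.map_sub_swap]
            exact h.1.trans (le_max_left _ _)
          · exact h.1.trans (le_max_right _ _))
      obtain ⟨z, hz⟩ := exists_isRootRadius v hdiv hf (a := c)
      refine ⟨⟨(c, z), hz⟩, fun x hx => ?_⟩
      have hcx := hc _ ⟨x, hx, rfl⟩
      exact ⟨hcx, x.2.radius_le hcx (hroot _) hz, x.2.valuation_eval_le hcx⟩)
    (fun {x y z} hxy hyz => by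
      refine ⟨?_, hyz.2.1.trans hxy.2.1, hyz.2.2.trans hxy.2.2⟩
      rw [← sub_add_sub_cancel z.1.1 y.1.1 x.1.1]
      exact v.map_add_le (hyz.1.trans hxy.2.1) hxy.1)
  obtain ⟨b, hb, hlt⟩ := m.2.exists_valuation_eval_lt hres (hroot _)
  obtain ⟨z, hz⟩ := exists_isRootRadius v hdiv hf (a := b)
  exact absurd (hm ⟨(b, z), hz⟩ ⟨hb, m.2.radius_le hb (hroot _) hz, hlt.le⟩).2.2 hlt.not_ge

end SphericallyComplete

/-! ### Teichmüller digits of Witt vectors -/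

section Digits

variable {p : ℕ} [Fact p.Prime] {k : Type*} [Field k] [CharP k p] [PerfectRing k p]

/-- The `n`-th digit of a Witt vector, so that `w = ∑ [digit w n] p ^ n`. -/
noncomputable def digit (w : WittVector p k) (n : ℕ) : k :=
  ((frobeniusEquiv k p).symm ^ n) (w.coeff n)

theorem digit_congr {w w' : WittVector p k} {N n : ℕ} (h : (p : WittVector p k) ^ N ∣ w - w')
    (hn : n < N) : digit w n = digit w' n := by
  rw [← Ideal.mem_span_singleton, WittVector.mem_span_p_pow_iff_le_coeff_eq_zero,
    ← WittVector.le_coeff_eq_iff_le_sub_coeff_eq_zero] at h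
  rw [digit, digit, h n hn]

theorem pow_dvd_sub_sum_digit (w : WittVector p k) (N : ℕ) : (p : WittVector p k) ^ N ∣
    w - ∑ n ∈ Finset.range N, WittVector.teichmuller p (digit w n) * (p : WittVector p k) ^ n := by
  cases N with
  | zero => simp
  | succ n =>
    rw [Nat.range_succ_eq_Iic]
    exact WittVector.dvd_sub_sum_teichmuller_iterateFrobeniusEquiv_coeff w n

theorem digit_zero (n : ℕ) : digit (0 : WittVector p k) n = 0 := by
  simp [digit]

theorem digit_mul_p_succ (w : WittVector p k) (n : ℕ) :
    digit (w * (p : WittVector p k)) (n + 1) = digit w n := by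
  rw [digit, digit, WittVector.mul_charP_coeff_succ, pow_succ]
  change ((frobeniusEquiv k p).symm ^ n) ((frobeniusEquiv k p).symm (w.coeff n ^ p)) = _
  rw [frobeniusEquiv_symm_pow]

theorem constantCoeff_eq_zero_of_dvd {w : WittVector p k} (h : (p : WittVector p k) ∣ w) :
    w.coeff 0 = 0 := by
  rwa [← WittVector.mem_span_p_iff_coeff_zero_eq_zero, Ideal.mem_span_singleton]

end Digits

/-! ### Teichmüller representatives of classes of series -/

section NormalForm

variable {G : Type*} [AddCommGroup G] [LinearOrder G] [IsOrderedAddMonoid G]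
variable {p : ℕ} [Fact p.Prime] {k : Type*} [Field k] [CharP k p]

/-- The Teichmüller lift as a zero-preserving map. -/
noncomputable def teichmullerZeroHom (p : ℕ) [Fact p.Prime] (k : Type*) [Field k] :
    ZeroHom k (WittVector p k) where
  toFun := WittVector.teichmuller p
  map_zero' := WittVector.teichmuller_zero p

/-- The series `∑ [r_g] t^g`. -/
noncomputable def teichmullerSeries (p : ℕ) [Fact p.Prime] (r : HahnSeries G k) :
    HahnSeries G (WittVector p k) :=
  r.map (teichmullerZeroHom p k)

theorem coeff_teichmullerSeries (r : HahnSeries G k) (g : G) :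
    (teichmullerSeries p r).coeff g = WittVector.teichmuller p (r.coeff g) := rfl

/-- The truncated sum `∑_{n < N} x_{j+n} p^n`. -/
noncomputable def shiftedSum (ι : ℤ →+o G) (x : HahnSeries G (WittVector p k)) (j : G) (N : ℕ) :
    WittVector p k :=
  ∑ n ∈ Finset.range N, x.coeff (j + ι (n : ℤ)) * (p : WittVector p k) ^ n

theorem pow_dvd_shiftedSum_sub (ι : ℤ →+o G) (x : HahnSeries G (WittVector p k)) (j : G)
    {M N : ℕ} (h : M ≤ N) :
    (p : WittVector p k) ^ M ∣ shiftedSum ι x j N - shiftedSum ι x j M := by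
  rw [shiftedSum, shiftedSum, ← Finset.sum_range_add_sum_Ico _ h, add_sub_cancel_left]
  exact Finset.dvd_sum fun n hn =>
    Dvd.dvd.mul_left (pow_dvd_pow _ (Finset.mem_Ico.1 hn).1) _

variable [PerfectRing k p]

/-- Starting one step earlier adds a zero term and multiplies the rest by `p`, so digits move up one
place. Thus the digit attached to `j` does not depend on the starting point. -/
theorem digit_shiftedSum_add_one {ι : ℤ →+o G} {x : HahnSeries G (WittVector p k)} {j : G} {m : ℕ}
    (hm : ∀ n : ℕ, m < n → x.coeff (j - ι (n : ℤ)) = 0) :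
    digit (shiftedSum ι x (j - ι ((m + 1 : ℕ) : ℤ)) (m + 1 + 1)) (m + 1) =
      digit (shiftedSum ι x (j - ι (m : ℤ)) (m + 1)) m := by
  have h : shiftedSum ι x (j - ι ((m + 1 : ℕ) : ℤ)) (m + 1 + 1) =
      shiftedSum ι x (j - ι (m : ℤ)) (m + 1) * (p : WittVector p k) := by
    rw [shiftedSum, Finset.sum_range_succ', Nat.cast_zero, map_zero, add_zero,
      hm _ (Nat.lt_succ_self m), zero_mul, add_zero, shiftedSum, Finset.sum_mul]
    refine Finset.sum_congr rfl fun n _ => ?_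
    rw [pow_succ, ← mul_assoc]
    congr 3
    push_cast
    rw [map_add, map_add]
    abel
  rw [h, digit_mul_p_succ]

theorem digit_shiftedSum_eq {ι : ℤ →+o G} {x : HahnSeries G (WittVector p k)} {j : G} {m m' : ℕ}
    (hm : ∀ n : ℕ, m < n → x.coeff (j - ι (n : ℤ)) = 0)
    (hm' : ∀ n : ℕ, m' < n → x.coeff (j - ι (n : ℤ)) = 0) :
    digit (shiftedSum ι x (j - ι (m : ℤ)) (m + 1)) m =
      digit (shiftedSum ι x (j - ι (m' : ℤ)) (m' + 1)) m' := by
  have key : ∀ m l : ℕ, (∀ n : ℕ, m < n → x.coeff (j - ι (n : ℤ)) = 0) →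
      digit (shiftedSum ι x (j - ι ((m + l : ℕ) : ℤ)) (m + l + 1)) (m + l) =
        digit (shiftedSum ι x (j - ι (m : ℤ)) (m + 1)) m := by
    intro m l hm
    induction l with
    | zero => rfl
    | succ l ih =>
      rw [← ih]
      exact digit_shiftedSum_add_one fun n hn => hm n ((Nat.le_add_right m l).trans_lt hn)
  rcases le_total m m' with h | h
  · obtain ⟨l, rfl⟩ := Nat.exists_eq_add_of_le h
    exact (key m l hm).symm
  · obtain ⟨l, rfl⟩ := Nat.exists_eq_add_of_le h
    exact key m' l hm'

open scoped Pointwise in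
theorem exists_isNull_sub_teichmullerSeries (ι : ℤ →+o G) (hι : Function.Injective ι)
    (x : HahnSeries G (WittVector p k)) :
    ∃ r : HahnSeries G k, IsNull ι (x - teichmullerSeries p r) := by
  -- Carries only move upwards along `ι`, so all digits are supported in this well-ordered set.
  set S : Set G := x.support + Set.range fun n : ℕ => ι (n : ℤ) with hS
  have hSpwo : S.IsPWO := by
    refine x.isPWO_support.add ?_
    rw [← Set.image_univ]
    refine (Set.isPWO_iff_isWF.2 (Set.IsWF.of_wellFoundedLT _)).image_of_monotone ?_
    intro a b hab
    exact ι.monotone' (by exact_mod_cast hab)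
  have hxS : ∀ g, g ∉ S → x.coeff g = 0 := fun g hg => by
    by_contra h
    exact hg (Set.mem_add.2 ⟨g, h, 0, ⟨0, by simp⟩, add_zero g⟩)
  have hgood : ∀ j : G, ∃ m : ℕ, ∀ n : ℕ, m < n → x.coeff (j - ι (n : ℤ)) = 0 := fun j => by
    obtain ⟨m, hm⟩ := exists_forall_notMem ι hι hSpwo j
    exact ⟨m, fun n hn => hxS _ (hm n hn)⟩
  choose m hm using hgood
  -- The `m j + 1` terms end with `x_j` itself; later ones are divisible by `p ^ (m j + 1)` and
  -- cannot affect digit `m j`.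
  set D : G → k := fun j => digit (shiftedSum ι x (j - ι (m j : ℤ)) (m j + 1)) (m j) with hD
  have hDS : ∀ j, j ∉ S → D j = 0 := fun j hj => by
    have : shiftedSum ι x (j - ι (m j : ℤ)) (m j + 1) = 0 := by
      refine Finset.sum_eq_zero fun n hn => ?_
      suffices x.coeff (j - ι (m j : ℤ) + ι (n : ℤ)) = 0 by rw [this, zero_mul]
      by_contra hne
      refine hj (Set.mem_add.2 ⟨_, hne, _, ⟨m j - n, rfl⟩, ?_⟩)
      dsimp only
      rw [Nat.cast_sub (Nat.lt_succ_iff.1 (Finset.mem_range.1 hn)), map_sub]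
      abel
    rw [hD]
    simp only [this, digit_zero]
  refine ⟨⟨D, hSpwo.mono fun j hj => by_contra fun h => hj (hDS j h)⟩, isNull_of_dvd fun i => ?_⟩
  obtain ⟨M, hM⟩ := exists_forall_notMem ι hι hSpwo i
  refine ⟨M, fun n hn => ?_, fun N => ?_⟩
  · rw [HahnSeries.coeff_sub, coeff_teichmullerSeries, hxS _ (hM n hn)]
    simp only [hDS _ (hM n hn), WittVector.teichmuller_zero, sub_zero]
  · convert pow_dvd_sub_sum_digit (shiftedSum ι x (i - ι (M : ℤ)) N) N using 1
    simp only [HahnSeries.coeff_sub, sub_mul, Finset.sum_sub_distrib, coeff_teichmullerSeries]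
    congr 1
    refine Finset.sum_congr rfl fun n hn => ?_
    rw [hD]
    dsimp only
    -- Restarting `n` steps below `i - ι M + ι n` makes every digit come from one sum based at `i -
    -- ι M`, which is then lengthened to `N` terms.
    rw [digit_shiftedSum_eq (hm _) (m' := n), add_sub_cancel_right,
      digit_congr (pow_dvd_shiftedSum_sub ι x (i - ι (M : ℤ))
        (Nat.succ_le_of_lt (Finset.mem_range.1 hn))) (Nat.lt_succ_self n)]
    intro l hl
    apply hxS
    convert hM (M + l - n) (by omega) using 2
    rw [Nat.cast_sub (by omega), Nat.cast_add, map_sub, map_add]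
    abel

end NormalForm

/-! ### Integral series, their residues, and gluing -/

section IntegralSeries

variable {G : Type*} [AddCommGroup G] [LinearOrder G] [IsOrderedAddMonoid G]
variable {p : ℕ} [Fact p.Prime] {k : Type*} [Field k] [CharP k p]

theorem coeff_zero_mul_of_forall_neg {x y : HahnSeries G (WittVector p k)}
    (hx : ∀ g < 0, x.coeff g = 0) (hy : ∀ g < 0, y.coeff g = 0) :
    (x * y).coeff 0 = x.coeff 0 * y.coeff 0 := by
  classical
  rw [coeff_mul_eq_sum x y 0 (B := {0})]
  · simp
  · intro a ha
    obtain ⟨⟨a, b⟩, hab, rfl⟩ := Finset.mem_image.1 ha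
    obtain ⟨h1, h2, h3⟩ := Finset.mem_antidiagonal.1 hab
    have ha0 : 0 ≤ a := not_lt.1 fun h => h1 (hx a h)
    have hb0 : 0 ≤ b := not_lt.1 fun h => h2 (hy b h)
    exact Finset.mem_singleton.2 ((add_eq_zero_iff_of_nonneg ha0 hb0).1 h3).1

/-- The subring of series with support in `[0, ∞)`. -/
def integralSeries (G : Type*) [AddCommGroup G] [LinearOrder G] [IsOrderedAddMonoid G]
    (p : ℕ) [Fact p.Prime] (k : Type*) [Field k] [CharP k p] :
    Subring (HahnSeries G (WittVector p k)) where
  carrier := {x | ∀ g < 0, x.coeff g = 0}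
  mul_mem' {x y} hx hy g hg := by
    by_contra hne
    obtain ⟨a, ha, b, hb, rfl⟩ := Set.mem_add.1 (HahnSeries.support_mul_subset hne)
    have ha0 : 0 ≤ a := not_lt.1 fun h => ha (hx a h)
    have hb0 : 0 ≤ b := not_lt.1 fun h => hb (hy b h)
    exact hg.not_ge (add_nonneg ha0 hb0)
  one_mem' g hg := by rw [HahnSeries.coeff_one, if_neg hg.ne]
  add_mem' hx hy g hg := by rw [HahnSeries.coeff_add, hx g hg, hy g hg, add_zero]
  zero_mem' _ _ := rfl
  neg_mem' hx g hg := by rw [HahnSeries.coeff_neg, hx g hg, neg_zero]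

theorem single_mem_integralSeries {g : G} (hg : 0 ≤ g) (w : WittVector p k) :
    HahnSeries.single g w ∈ integralSeries G p k := fun _ hi =>
  HahnSeries.coeff_single_of_ne (hi.trans_le hg).ne

theorem single_mul_mem_integralSeries {g : G} {x : HahnSeries G (WittVector p k)}
    (hx : ∀ i < g, x.coeff i = 0) : HahnSeries.single (-g) 1 * x ∈ integralSeries G p k := by
  intro i hi
  rw [HahnSeries.coeff_single_mul, one_mul, sub_neg_eq_add]
  exact hx _ (by simpa using hi)

theorem single_mul_single_neg (g : G) :
    (HahnSeries.single g 1 * HahnSeries.single (-g) 1 : HahnSeries G (WittVector p k)) = 1 := by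
  rw [HahnSeries.single_mul_single, add_neg_cancel, one_mul, HahnSeries.single_zero_one]

/-- The residue map on integral series. -/
noncomputable def residue (G : Type*) [AddCommGroup G] [LinearOrder G] [IsOrderedAddMonoid G]
    (p : ℕ) [Fact p.Prime] (k : Type*) [Field k] [CharP k p] : integralSeries G p k →+* k where
  toFun x := WittVector.constantCoeff (x.1.coeff 0)
  map_one' := by simp [HahnSeries.coeff_one]
  map_mul' x y := by
    rw [Subring.coe_mul, coeff_zero_mul_of_forall_neg x.2 y.2, map_mul]
  map_zero' := by simp
  map_add' x y := by rw [Subring.coe_add, HahnSeries.coeff_add, map_add]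

theorem residue_apply (x : integralSeries G p k) : residue G p k x = (x.1.coeff 0).coeff 0 := rfl

theorem residue_surjective : Function.Surjective (residue G p k) := fun c =>
  ⟨⟨HahnSeries.single 0 (WittVector.teichmuller p c), single_mem_integralSeries le_rfl _⟩, by
    simp [residue_apply]⟩

/-- The leading coefficient sits at exponent 0 and is a unit of the local ring `W(k)`; the inverse
series has order 0 because orders add. -/
theorem exists_mul_eq_one_of_residue_ne_zero [PerfectRing k p] {x : integralSeries G p k}
    (hx : residue G p k x ≠ 0) : ∃ y : integralSeries G p k, x * y = 1 := by
  have hx0 : x.1.coeff 0 ≠ 0 := fun h => hx (by rw [residue_apply, h, WittVector.zero_coeff])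
  have hne : x.1 ≠ 0 := fun h => hx0 (by rw [h, HahnSeries.coeff_zero])
  have hord : x.1.order = 0 := by
    refine le_antisymm (HahnSeries.order_le_of_coeff_ne_zero hx0) (not_lt.1 fun h => ?_)
    exact HahnSeries.coeff_order_eq_zero.not.2 hne (x.2 _ h)
  have hu : IsUnit x.1 := by
    rw [HahnSeries.isUnit_iff, HahnSeries.leadingCoeff_eq, hord]
    exact WittVector.isUnit_of_coeff_zero_ne_zero _ hx
  obtain ⟨y, hy⟩ := hu.exists_right_inv
  have hy0 : y ≠ 0 := by
    rintro rfl
    simp at hy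
  have hyord : y.order = 0 := by
    have := HahnSeries.order_mul hne hy0
    rwa [hy, HahnSeries.order_one, hord, zero_add, eq_comm] at this
  refine ⟨⟨y, fun g hg => HahnSeries.coeff_eq_zero_of_lt_order (hyord ▸ hg)⟩, Subtype.ext hy⟩

/-- With nothing below `i`, the vanishing sum at `i` reduces modulo `p` to `x_i`. This makes
residues well defined on classes. -/
theorem IsNull.coeff_zero_eq_zero [PerfectRing k p] {ι : ℤ →+o G} (hι : Function.Injective ι)
    {x : HahnSeries G (WittVector p k)}
    (hx : IsNull ι x) {i : G} (hi : ∀ j < i, x.coeff j = 0) : (x.coeff i).coeff 0 = 0 := by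
  refine constantCoeff_eq_zero_of_dvd ?_
  have := hx.dvd (i := i) (fun n hn => hi _ (sub_lt_self i ?_)) 1
  · simpa using this
  · rw [← map_zero ι]
    exact strictMono_of_injective ι hι (by exact_mod_cast hn)

/-- A descending sequence in the glued support stays below any `g x` exceeding its first term, hence
lies in the support of `r x`. The default value 0 guarantees such an `x`. -/
theorem exists_glue {I : Type*} (r : I → HahnSeries G k) (g : I → G)
    (h : ∀ x y, ∀ i, i < g x → i < g y → (r x).coeff i = (r y).coeff i) :
    ∃ c : HahnSeries G k, ∀ x, ∀ i < g x, c.coeff i = (r x).coeff i := by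
  classical
  set c : G → k := fun i => if hi : ∃ x, i < g x then (r hi.choose).coeff i else 0 with hc
  have hcr : ∀ x, ∀ i < g x, c i = (r x).coeff i := fun x i hi => by
    have hex : ∃ x, i < g x := ⟨x, hi⟩
    rw [hc]
    simp only [dif_pos hex]
    exact h _ _ i hex.choose_spec hi
  refine ⟨⟨c, Set.isPWO_iff_isWF.2 (Set.isWF_iff_no_descending_seq.2 fun f hf hmem => ?_)⟩, hcr⟩
  obtain ⟨x, hx⟩ : ∃ x, f 0 < g x := by
    by_contra hno
    exact hmem 0 (dif_neg hno)
  refine Set.isWF_iff_no_descending_seq.1 (r x).isWF_support f hf fun n => ?_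
  have hn : f n ≤ f 0 := hf.antitone (Nat.zero_le n)
  have := hmem n
  rw [Function.mem_support, hcr x _ (hn.trans_lt hx)] at this
  exact this

end IntegralSeries

/-! ### The quotient as a valued field -/

section Quotient

variable {G : Type*} [AddCommGroup G] [LinearOrder G] [IsOrderedAddMonoid G]
variable {p : ℕ} [Fact p.Prime] {k : Type*} [Field k] [CharP k p] [PerfectRing k p]
variable {ι : ℤ →+o G}

/-- Take the Teichmüller representative and factor out its leading power of `t`; the residue is then
the leading digit. An abstract `π` serves both before and after the quotient is known to be a field.
-/
theorem exists_eq_map_single_mul {L : Type*} [CommRing L] (hι : Function.Injective ι)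
    {π : HahnSeries G (WittVector p k) →+* L} (hsurj : Function.Surjective π)
    (hker : ∀ x, π x = 0 ↔ IsNull ι x) {x : L} (hx : x ≠ 0) :
    ∃ (g : G) (u : integralSeries G p k), residue G p k u ≠ 0 ∧
      x = π (HahnSeries.single g 1) * π u := by
  obtain ⟨X, rfl⟩ := hsurj x
  obtain ⟨r, hr⟩ := exists_isNull_sub_teichmullerSeries ι hι X
  rw [← hker, map_sub, sub_eq_zero] at hr
  have hr0 : r ≠ 0 := by
    rintro rfl
    refine hx (hr.trans ?_)
    have : teichmullerSeries p (0 : HahnSeries G k) = 0 := HahnSeries.map_zero _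
    rw [this, map_zero]
  refine ⟨r.order, ⟨HahnSeries.single (-r.order) 1 * teichmullerSeries p r,
    single_mul_mem_integralSeries fun i hi => ?_⟩, ?_, ?_⟩
  · rw [coeff_teichmullerSeries, HahnSeries.coeff_eq_zero_of_lt_order hi,
      WittVector.teichmuller_zero]
  · rw [residue_apply]
    simp only [HahnSeries.coeff_single_mul, one_mul, zero_sub, neg_neg, coeff_teichmullerSeries,
      WittVector.teichmuller_coeff_zero]
    exact HahnSeries.coeff_order_eq_zero.not.2 hr0
  · rw [hr, ← map_mul, ← mul_assoc, single_mul_single_neg, one_mul]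

theorem isField_of_ker_eq {L : Type*} [CommRing L] (hι : Function.Injective ι)
    {π : HahnSeries G (WittVector p k) →+* L} (hsurj : Function.Surjective π)
    (hker : ∀ x, π x = 0 ↔ IsNull ι x) : IsField L where
  exists_pair_ne := by
    refine ⟨0, 1, fun h => ?_⟩
    have h1 := ((hker 1).1 (by rw [map_one, h])).coeff_zero_eq_zero hι (i := 0)
      (integralSeries G p k).one_mem
    simp [HahnSeries.coeff_one] at h1
  mul_comm := mul_comm
  mul_inv_cancel {x} hx := by
    obtain ⟨g, u, hu, rfl⟩ := exists_eq_map_single_mul hι hsurj hker hx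
    obtain ⟨y, hy⟩ := exists_mul_eq_one_of_residue_ne_zero hu
    refine ⟨π (HahnSeries.single (-g) 1) * π y, ?_⟩
    rw [mul_mul_mul_comm, ← map_mul, ← map_mul, single_mul_single_neg, ← Subring.coe_mul, hy]
    simp

variable {L : Type*} [Field L]

/-- The valuation ring of `W(k)((p^G))`: the classes of the integral series. -/
noncomputable def valuationSubringOfKerEq (hι : Function.Injective ι)
    {π : HahnSeries G (WittVector p k) →+* L} (hsurj : Function.Surjective π)
    (hker : ∀ x, π x = 0 ↔ IsNull ι x) : ValuationSubring L where
  toSubring := (integralSeries G p k).map π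
  mem_or_inv_mem' x := by
    rcases eq_or_ne x 0 with rfl | hx
    · exact Or.inl (Subring.zero_mem _)
    obtain ⟨g, u, hu, rfl⟩ := exists_eq_map_single_mul hι hsurj hker hx
    rcases le_total 0 g with hg | hg
    · refine Or.inl ⟨HahnSeries.single g 1 * u.1, ?_, map_mul _ _ _⟩
      exact mul_mem (single_mem_integralSeries hg 1) u.2
    · obtain ⟨y, hy⟩ := exists_mul_eq_one_of_residue_ne_zero hu
      refine Or.inr ⟨HahnSeries.single (-g) 1 * y.1,
        mul_mem (single_mem_integralSeries (neg_nonneg.2 hg) 1) y.2, ?_⟩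
      refine eq_inv_of_mul_eq_one_right ?_
      rw [map_mul, mul_mul_mul_comm, ← map_mul, ← map_mul, single_mul_single_neg,
        ← Subring.coe_mul, hy]
      simp

variable (hι : Function.Injective ι)
  {π : HahnSeries G (WittVector p k) →+* L} (hsurj : Function.Surjective π)
  (hker : ∀ x, π x = 0 ↔ IsNull ι x)

theorem mem_valuationSubringOfKerEq {x : L} :
    x ∈ valuationSubringOfKerEq hι hsurj hker ↔ ∃ u : integralSeries G p k, π u = x := by
  constructor
  · rintro ⟨u, hu, rfl⟩
    exact ⟨⟨u, hu⟩, rfl⟩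
  · rintro ⟨u, rfl⟩
    exact ⟨u, u.2, rfl⟩

theorem valuation_le_iff_exists {x y : L} :
    (valuationSubringOfKerEq hι hsurj hker).valuation x ≤
      (valuationSubringOfKerEq hι hsurj hker).valuation y ↔
      ∃ u : integralSeries G p k, π u * y = x := by
  rw [ValuationSubring.valuation_le_iff]
  constructor
  · rintro ⟨⟨_, ha⟩, rfl⟩
    obtain ⟨u, rfl⟩ := (mem_valuationSubringOfKerEq hι hsurj hker).1 ha
    exact ⟨u, rfl⟩
  · rintro ⟨u, rfl⟩
    exact ⟨⟨π u, (mem_valuationSubringOfKerEq hι hsurj hker).2 ⟨u, rfl⟩⟩, rfl⟩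

theorem valuation_map_integral_le_one (u : integralSeries G p k) :
    (valuationSubringOfKerEq hι hsurj hker).valuation (π u) ≤ 1 :=
  (ValuationSubring.valuation_le_one_iff _ _).2
    ((mem_valuationSubringOfKerEq hι hsurj hker).2 ⟨u, rfl⟩)

theorem residue_eq_zero_of_map_eq_zero {ι : ℤ →+o G} (hι : Function.Injective ι)
    {π : HahnSeries G (WittVector p k) →+* L} (hker : ∀ x, π x = 0 ↔ IsNull ι x)
    {u : integralSeries G p k} (hu : π u = 0) : residue G p k u = 0 :=
  ((hker u).1 hu).coeff_zero_eq_zero hι u.2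

/-- A nonzero residue gives an integral inverse; conversely, the residue factors through `π`, so an
inverse in the valuation ring forces it to be nonzero. -/
theorem valuation_map_integral_lt_one_iff (u : integralSeries G p k) :
    (valuationSubringOfKerEq hι hsurj hker).valuation (π u) < 1 ↔ residue G p k u = 0 := by
  rw [← not_le, ← map_one (valuationSubringOfKerEq hι hsurj hker).valuation,
    valuation_le_iff_exists, not_iff_comm]
  constructor
  · intro hu
    obtain ⟨y, hy⟩ := exists_mul_eq_one_of_residue_ne_zero hu
    exact ⟨y, by rw [← map_mul, ← Subring.coe_mul, mul_comm, hy, Subring.coe_one, map_one]⟩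
  · rintro ⟨y, hy⟩ hu
    have h := residue_eq_zero_of_map_eq_zero hι hker (u := y * u - 1) (by
      rw [AddSubgroupClass.coe_sub, Subring.coe_mul, Subring.coe_one, map_sub, map_mul, hy, map_one,
        sub_self])
    rw [map_sub, map_mul, hu, mul_zero, map_one, zero_sub, neg_eq_zero] at h
    exact one_ne_zero h

theorem valuation_map_single_le (g h : G) (hgh : h ≤ g) :
    (valuationSubringOfKerEq hι hsurj hker).valuation (π (HahnSeries.single g 1)) ≤
      (valuationSubringOfKerEq hι hsurj hker).valuation (π (HahnSeries.single h 1)) := by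
  rw [valuation_le_iff_exists]
  refine ⟨⟨HahnSeries.single (g - h) 1, single_mem_integralSeries (sub_nonneg.2 hgh) 1⟩, ?_⟩
  rw [← map_mul, HahnSeries.single_mul_single, sub_add_cancel, one_mul]

theorem exists_valuation_eq_map_single {x : L} (hx : x ≠ 0) :
    ∃ g : G, (valuationSubringOfKerEq hι hsurj hker).valuation x =
      (valuationSubringOfKerEq hι hsurj hker).valuation (π (HahnSeries.single g 1)) := by
  obtain ⟨g, u, hu, rfl⟩ := exists_eq_map_single_mul hι hsurj hker hx
  refine ⟨g, ?_⟩
  have h1 : (valuationSubringOfKerEq hι hsurj hker).valuation (π u) = 1 :=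
    (valuation_map_integral_le_one hι hsurj hker u).eq_of_not_lt
      ((valuation_map_integral_lt_one_iff hι hsurj hker u).not.2 hu)
  rw [map_mul, h1, mul_one]

theorem valuation_sub_teichmullerSeries_le_iff (r s : HahnSeries G k) (g : G) :
    (valuationSubringOfKerEq hι hsurj hker).valuation
        (π (teichmullerSeries p r) - π (teichmullerSeries p s)) ≤
      (valuationSubringOfKerEq hι hsurj hker).valuation (π (HahnSeries.single g 1)) ↔
      ∀ i < g, r.coeff i = s.coeff i := by
  rw [valuation_le_iff_exists, ← map_sub]
  constructor
  · rintro ⟨u, hu⟩ i hi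
    by_contra hne
    have hrs : r - s ≠ 0 := fun h => hne (by rw [sub_eq_zero.1 h])
    -- At the first disagreement `j < g`, the series `u t^g` contributes nothing, so the null
    -- difference has leading coefficient `[r_j] - [s_j]`, whose residue `r_j - s_j` would have to
    -- vanish.
    set j := (r - s).order with hj
    have hji : j ≤ i := HahnSeries.order_le_of_coeff_ne_zero
      (by rwa [HahnSeries.coeff_sub, sub_ne_zero])
    have hlt : ∀ l < j, r.coeff l = s.coeff l := fun l hl => by
      have := HahnSeries.coeff_eq_zero_of_lt_order hl
      rwa [HahnSeries.coeff_sub, sub_eq_zero] at this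
    have hu0 : ∀ l ≤ j, (u.1 * HahnSeries.single g 1).coeff l = 0 := fun l hl => by
      rw [HahnSeries.coeff_mul_single, u.2 _ (sub_neg.2 (hl.trans_lt (hji.trans_lt hi))), zero_mul]
    rw [← map_mul, eq_comm, ← sub_eq_zero, ← map_sub, hker] at hu
    have h0 := hu.coeff_zero_eq_zero hι (i := j) fun l hl => by
      rw [HahnSeries.coeff_sub, hu0 l hl.le, HahnSeries.coeff_sub, coeff_teichmullerSeries,
        coeff_teichmullerSeries, hlt l hl, sub_self, sub_self]
    rw [HahnSeries.coeff_sub, hu0 j le_rfl, HahnSeries.coeff_sub, sub_zero,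
      coeff_teichmullerSeries, coeff_teichmullerSeries, ← WittVector.constantCoeff_apply, map_sub,
      WittVector.constantCoeff_apply, WittVector.constantCoeff_apply,
      WittVector.teichmuller_coeff_zero, WittVector.teichmuller_coeff_zero,
      ← HahnSeries.coeff_sub] at h0
    exact HahnSeries.coeff_order_eq_zero.not.2 hrs h0
  · intro h
    refine ⟨⟨HahnSeries.single (-g) 1 * (teichmullerSeries p r - teichmullerSeries p s),
      single_mul_mem_integralSeries fun i hi => ?_⟩, ?_⟩
    · rw [HahnSeries.coeff_sub, coeff_teichmullerSeries, coeff_teichmullerSeries, h i hi, sub_self]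
    · rw [← map_mul, mul_right_comm, mul_comm (HahnSeries.single (-g) 1), single_mul_single_neg,
        one_mul]

theorem exists_valuation_pow_eq (hG : ∀ n : ℕ, n ≠ 0 → ∀ g : G, ∃ h : G, n • h = g)
    {n : ℕ} (hn : n ≠ 0) (c : L) :
    ∃ y, (valuationSubringOfKerEq hι hsurj hker).valuation y ^ n =
      (valuationSubringOfKerEq hι hsurj hker).valuation c := by
  rcases eq_or_ne c 0 with rfl | hc
  · exact ⟨0, by rw [map_zero, zero_pow hn]⟩
  obtain ⟨g, hg⟩ := exists_valuation_eq_map_single hι hsurj hker hc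
  obtain ⟨h, rfl⟩ := hG n hn g
  exact ⟨π (HahnSeries.single h 1), by
    rw [hg, ← map_pow, ← map_pow, HahnSeries.single_pow, one_pow]⟩

theorem exists_valuation_eval_lt_one [IsAlgClosed k] (q : L[X])
    (hq : ∀ i, (valuationSubringOfKerEq hι hsurj hker).valuation (q.coeff i) ≤ 1)
    (hq1 : ∃ i, i ≠ 0 ∧ (valuationSubringOfKerEq hι hsurj hker).valuation (q.coeff i) = 1) :
    ∃ u, (valuationSubringOfKerEq hι hsurj hker).valuation u ≤ 1 ∧
      (valuationSubringOfKerEq hι hsurj hker).valuation (q.eval u) < 1 := by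
  set φ : integralSeries G p k →+* L := π.comp (integralSeries G p k).subtype with hφ
  have hlift : q ∈ Polynomial.lifts φ := by
    rw [Polynomial.lifts_iff_coeff_lifts]
    intro i
    obtain ⟨u, hu⟩ := (mem_valuationSubringOfKerEq hι hsurj hker).1
      ((ValuationSubring.valuation_le_one_iff _ _).1 (hq i))
    exact ⟨u, hu⟩
  obtain ⟨Q, rfl⟩ := (Polynomial.mem_lifts _).1 hlift
  obtain ⟨i, hi, hi1⟩ := hq1
  have hres : (Q.map (residue G p k)).coeff i ≠ 0 := by
    rw [coeff_map] at hi1 ⊢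
    exact (valuation_map_integral_lt_one_iff hι hsurj hker _).not.1 hi1.not_lt
  obtain ⟨z, hz⟩ := IsAlgClosed.exists_root (Q.map (residue G p k)) fun hd =>
    hres (coeff_eq_zero_of_degree_lt (hd ▸ (by exact_mod_cast Nat.pos_of_ne_zero hi)))
  obtain ⟨u, rfl⟩ := residue_surjective (G := G) (p := p) z
  refine ⟨φ u, valuation_map_integral_le_one hι hsurj hker u, ?_⟩
  rw [eval_map_apply]
  exact (valuation_map_integral_lt_one_iff hι hsurj hker _).2 (by
    rwa [IsRoot, eval_map_apply] at hz)

/-- Writing radii as `v(t^g)`, the larger of two radii has the smaller exponent, so the digits of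
two centres agree below both exponents and can be glued into a common point. -/
theorem exists_valuation_sub_le (C : Set (L × L)) (hC : ∀ x ∈ C, x.2 ≠ 0)
    (hCC : ∀ x ∈ C, ∀ y ∈ C, (valuationSubringOfKerEq hι hsurj hker).valuation (x.1 - y.1) ≤
      max ((valuationSubringOfKerEq hι hsurj hker).valuation x.2)
        ((valuationSubringOfKerEq hι hsurj hker).valuation y.2)) :
    ∃ c, ∀ x ∈ C, (valuationSubringOfKerEq hι hsurj hker).valuation (c - x.1) ≤
      (valuationSubringOfKerEq hι hsurj hker).valuation x.2 := by
  have hr : ∀ x : C, ∃ r : HahnSeries G k, π (teichmullerSeries p r) = x.1.1 := fun x => by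
    obtain ⟨X, hX⟩ := hsurj x.1.1
    obtain ⟨r, hr⟩ := exists_isNull_sub_teichmullerSeries ι hι X
    rw [← hker, map_sub, sub_eq_zero, hX] at hr
    exact ⟨r, hr.symm⟩
  choose r hr using hr
  choose g hg using fun x : C => exists_valuation_eq_map_single hι hsurj hker (hC x x.2)
  obtain ⟨c, hc⟩ := exists_glue r g fun x y i hx hy => by
    have h := hCC x x.2 y y.2
    rw [← hr, ← hr, hg, hg] at h
    refine (valuation_sub_teichmullerSeries_le_iff hι hsurj hker (r x) (r y)
      (min (g x) (g y))).1 (h.trans (max_le ?_ ?_)) i (lt_min hx hy)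
    · exact valuation_map_single_le hι hsurj hker _ _ (min_le_left _ _)
    · exact valuation_map_single_le hι hsurj hker _ _ (min_le_right _ _)
  refine ⟨π (teichmullerSeries p c), fun x hx => ?_⟩
  have h := (valuation_sub_teichmullerSeries_le_iff hι hsurj hker c (r ⟨x, hx⟩)
    (g ⟨x, hx⟩)).2 (hc ⟨x, hx⟩)
  rwa [hr, ← hg] at h

theorem isAlgClosed_of_ker_eq [IsAlgClosed k] (hι : Function.Injective ι)
    {π : HahnSeries G (WittVector p k) →+* L} (hsurj : Function.Surjective π)
    (hker : ∀ x, π x = 0 ↔ IsNull ι x)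
    (hG : ∀ n : ℕ, n ≠ 0 → ∀ g : G, ∃ h : G, n • h = g) : IsAlgClosed L :=
  isAlgClosed_of_sphericallyComplete (valuationSubringOfKerEq hι hsurj hker).valuation
    (fun _ hn => exists_valuation_pow_eq hι hsurj hker hG hn)
    (exists_valuation_eval_lt_one hι hsurj hker)
    (exists_valuation_sub_le hι hsurj hker)

end Quotient

end GenPadic

theorem mainTheorem5 {G : Type*} [AddCommGroup G] [LinearOrder G] [IsOrderedAddMonoid G]
    (hG : ∀ n : ℕ, n ≠ 0 → ∀ g : G, ∃ h : G, n • h = g)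
    (ι : ℤ →+o G) (hι : Function.Injective ι)
    (p : ℕ) [Fact p.Prime] (R : Type*) [Field R] [CharP R p] [IsAlgClosed R] :
    ∃ hF : IsField (GenPadic.PadicSeries p R ι hι),
      @IsAlgClosed (GenPadic.PadicSeries p R ι hι) hF.toField := by
  have : ExpChar R p := ExpChar.prime Fact.out
  have : PerfectRing R p := inferInstance
  have hker : ∀ x, Ideal.Quotient.mk (GenPadic.nullIdeal p R ι hι) x = 0 ↔
      GenPadic.IsNull ι x := fun x => Ideal.Quotient.eq_zero_iff_mem
  have hF : IsField (GenPadic.PadicSeries p R ι hι) := GenPadic.isField_of_ker_eq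
    (L := GenPadic.PadicSeries p R ι hι) hι
    (π := Ideal.Quotient.mk (GenPadic.nullIdeal p R ι hι)) Ideal.Quotient.mk_surjective hker
  refine ⟨hF, ?_⟩
  let := hF.toField
  exact GenPadic.isAlgClosed_of_ker_eq (L := GenPadic.PadicSeries p R ι hι) hι
    (π := Ideal.Quotient.mk (GenPadic.nullIdeal p R ι hι)) Ideal.Quotient.mk_surjective hker hG
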